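/- Let $n,m\in\mathbb N$ (with $m=0$ allowed), $a\in\mathbb R$, and let $S\subset\mathbb R^n_+=[0,\infty)^n$ be compact and convex with $0\in S$. Write $\mathbb C^{*n}=(\mathbb C\setminus\{0\})^n$ and $\operatorname{Log} z=(\log|z_1|,\dots,\log|z_n|)$ for $z\in\mathbb C^{*n}$, let $\varphi_S(\xi)=\sup_{s\in S}\langle s,\xi\rangle$ for $\xi\in\mathbb R^n$, and define $H_S:\mathbb C^n\to\mathbb R$ by $H_S(z)=\varphi_S(\operatorname{Log} z)$ for $z\in\mathbb C^{*n}$ and $H_S(z)=\limsup_{\mathbb C^{*n}\ni w\to z}H_S(w)$ for $z\in\mathbb C^n\setminus\mathbb C^{*n}$. Put $\nu(z)=\langle\mathbf 1,\operatorname{Log} z\rangle=\sum_{j}\log|z_j|$ for $z\in\mathbb C^{*n}$, let $|z|$ be the Euclidean norm and $\lambda$ the Lebesgue measure on $\mathbb C^n$. Let $u\in C^1(\mathbb C^n)$ be a complex-valued function (continuously differentiable in the real sense) such that $\bar\partial u=\sum_j \frac{\partial u}{\partial\bar z_j}\,d\bar z_j$ has compact support. If $$\int_{\mathbb C^n}|u(z)|^2(1+|z|^2)^{-a}e^{-2mH_S(z)-2\nu(z)}\,d\lambda(z)<+\infty,$$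 then there exists a constant $C>0$ such that $$|u(z)|\le C(1+|z|)^a e^{mH_S(z)}\qquad\text{for all } z\in\mathbb C^n.$$ (The integrand is defined on $\mathbb C^{*n}$, whose complement is $\lambda$-null when $n\ge 1$.) -/

import Mathlib

open scoped Topology

noncomputable section

namespace LogSupport

/-- `ℂ*ⁿ`: the points of `ℂⁿ` all of whose coordinates are nonzero. -/
def cstar (n : ℕ) : Set (EuclideanSpace ℂ (Fin n)) := {z | ∀ j, z j ≠ 0}

/-- `Log z = (log |z₁|, …, log |zₙ|)`, meaningful for `z ∈ ℂ*ⁿ`. -/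
def Log {n : ℕ} (z : EuclideanSpace ℂ (Fin n)) : EuclideanSpace ℝ (Fin n) :=
  WithLp.toLp 2 fun j => Real.log ‖z j‖

/-- The supporting function `φ_S(ξ) = sup_{s ∈ S} ⟨s, ξ⟩`; a genuine supremum when `S` is
nonempty and compact. -/
def suppFun {n : ℕ} (S : Set (EuclideanSpace ℝ (Fin n))) (ξ : EuclideanSpace ℝ (Fin n)) : ℝ :=
  sSup ((fun s => inner ℝ s ξ) '' S)

open scoped Classical in
/-- The logarithmic supporting function `H_S`: it is `φ_S(Log z)` on `ℂ*ⁿ`, extended to the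
coordinate hyperplanes by the upper limit along `ℂ*ⁿ`. For compact `S ⊆ ℝ₊ⁿ` containing `0`,
`φ_S ∘ Log` is nonnegative and locally bounded above at every point of `ℂⁿ`, so the
real-valued upper limit is the usual one. -/
def logSuppFun {n : ℕ} (S : Set (EuclideanSpace ℝ (Fin n))) (z : EuclideanSpace ℂ (Fin n)) : ℝ :=
  if z ∈ cstar n then suppFun S (Log z)
  else Filter.limsup (fun w => suppFun S (Log w)) (𝓝[cstar n] z)

/-- `ν(z) = ⟨𝟏, Log z⟩`, with `𝟏 = (1, …, 1)`, meaningful for `z ∈ ℂ*ⁿ`. -/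
def nu {n : ℕ} (z : EuclideanSpace ℂ (Fin n)) : ℝ :=
  inner ℝ (WithLp.toLp 2 fun _ => (1 : ℝ)) (Log z)

/-- `∂̄u`, the (0,1)-form `∑ⱼ (∂u/∂z̄ⱼ) dz̄ⱼ` given by its coefficients
`∂u/∂z̄ⱼ = (∂u/∂xⱼ + i ∂u/∂yⱼ) / 2`. -/
def dbar {n : ℕ} (u : EuclideanSpace ℂ (Fin n) → ℂ) (z : EuclideanSpace ℂ (Fin n)) :
    Fin n → ℂ := fun j =>
  (fderiv ℝ u z (EuclideanSpace.single j 1)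
    + Complex.I * fderiv ℝ u z (EuclideanSpace.single j Complex.I)) / 2

end LogSupport

end

namespace LogSupport

open MeasureTheory Metric Set

/-! Fix `z` in `ℂ*ⁿ` with `‖z‖ > 2R`, where `∂̄u` vanishes outside the ball of radius `R`. The
points with coordinates `z j * (1 + ζ j)`, `‖ζ‖ < 1/2`, stay in `ℂ*ⁿ` and have coordinates within a
factor 2 of those of `z`. Hence `u` is holomorphic there, and all the weights are comparable to
their values at `z`, uniformly in `z`. The mean value inequality for `u ^ 2` in the variable `ζ`
bounds `‖u z‖ ^ 2` by an integral over this region. The Jacobian `∏ ‖z j‖ ^ 2 = e^{2ν(z)}` of the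
scaling exactly absorbs the weight `e^{-2ν}`; this is `norm_sq_mul_volume_le`. For `‖z‖ ≤ 2R`,
compactness and `H_S ≥ 0` suffice. The coordinate hyperplanes follow by density of `ℂ*ⁿ`, continuity
of `u` and the upper limit defining `H_S`. -/

/-! ### Diagonal changes of variables -/

/-- Coordinatewise multiplication by a vector with nonzero entries. -/
noncomputable def diagEquiv {n : ℕ} (c : Fin n → ℂ) (hc : ∀ j, c j ≠ 0) :
    EuclideanSpace ℂ (Fin n) ≃ₗ[ℂ] EuclideanSpace ℂ (Fin n) where
  toFun ζ := WithLp.toLp 2 fun j => c j * ζ j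
  invFun ζ := WithLp.toLp 2 fun j => (c j)⁻¹ * ζ j
  map_add' x y := by ext j; simp [mul_add]
  map_smul' t x := by ext j; simp [mul_left_comm]
  left_inv x := by ext j; simp [hc j]
  right_inv x := by ext j; simp [hc j]

@[simp]
theorem diagEquiv_apply {n : ℕ} (c : Fin n → ℂ) (hc : ∀ j, c j ≠ 0)
    (ζ : EuclideanSpace ℂ (Fin n)) (j : Fin n) : diagEquiv c hc ζ j = c j * ζ j := rfl

theorem det_diagEquiv {n : ℕ} (c : Fin n → ℂ) (hc : ∀ j, c j ≠ 0) :
    LinearMap.det (diagEquiv c hc : EuclideanSpace ℂ (Fin n) →ₗ[ℂ] EuclideanSpace ℂ (Fin n))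
      = ∏ j, c j := by
  have h : (diagEquiv c hc : EuclideanSpace ℂ (Fin n) →ₗ[ℂ] EuclideanSpace ℂ (Fin n))
      = Matrix.toLin (EuclideanSpace.basisFun (Fin n) ℂ).toBasis
        (EuclideanSpace.basisFun (Fin n) ℂ).toBasis (Matrix.diagonal c) := by
    refine (EuclideanSpace.basisFun (Fin n) ℂ).toBasis.ext fun i => ?_
    rw [Matrix.toLin_self]
    ext j
    by_cases hij : j = i
    · subst hij; simp [Matrix.diagonal_apply]
    · simp [Matrix.diagonal_apply, hij]
  rw [h, LinearMap.det_toLin, Matrix.det_diagonal]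

/-- The real determinant of a complex-linear map is the squared modulus of its complex determinant.
-/
theorem lintegral_comp_diagEquiv {n : ℕ} (c : Fin n → ℂ) (hc : ∀ j, c j ≠ 0)
    (f : EuclideanSpace ℂ (Fin n) → ENNReal) :
    ∫⁻ ζ, f (diagEquiv c hc ζ) = ENNReal.ofReal (∏ j, ‖c j‖ ^ 2)⁻¹ * ∫⁻ w, f w := by
  set e := ((diagEquiv c hc).restrictScalars ℝ).toContinuousLinearEquiv.toHomeomorph.toMeasurableEquiv
  set A : EuclideanSpace ℂ (Fin n) →ₗ[ℝ] EuclideanSpace ℂ (Fin n) :=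
    ((diagEquiv c hc : EuclideanSpace ℂ (Fin n) →ₗ[ℂ] EuclideanSpace ℂ (Fin n)).restrictScalars ℝ)
  have hdet : LinearMap.det A = ∏ j, ‖c j‖ ^ 2 := by
    rw [LinearMap.det_restrictScalars, det_diagEquiv, map_prod]
    simp [Algebra.norm_complex_apply, Complex.normSq_eq_norm_sq]
  have hpos : 0 < ∏ j, ‖c j‖ ^ 2 := Finset.prod_pos fun j _ => by
    have := norm_pos_iff.2 (hc j); positivity
  have hmap := Measure.map_linearMap_addHaar_eq_smul_addHaar
    (volume : Measure (EuclideanSpace ℂ (Fin n))) (f := A) (by rw [hdet]; exact hpos.ne')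
  have h := lintegral_map_equiv (μ := (volume : Measure (EuclideanSpace ℂ (Fin n)))) f e
  have he : (e : EuclideanSpace ℂ (Fin n) → EuclideanSpace ℂ (Fin n)) = A := rfl
  rw [he, hmap, lintegral_smul_measure, hdet, abs_of_pos (inv_pos.2 hpos)] at h
  exact h.symm

/-! ### Mean value inequality on balls -/

theorem lintegral_ball_smul {n : ℕ} (r : ℝ) (t : ℂ) (ht : ‖t‖ = 1)
    (f : EuclideanSpace ℂ (Fin n) → ENNReal) :
    ∫⁻ ζ in ball 0 r, f (t • ζ) = ∫⁻ ζ in ball 0 r, f ζ := by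
  have ht0 : t ≠ 0 := norm_pos_iff.1 (by rw [ht]; exact one_pos)
  have h := lintegral_comp_diagEquiv (fun _ : Fin n => t) (fun _ => ht0)
    ((ball 0 r).indicator f)
  have hs : ∀ ζ, diagEquiv (fun _ : Fin n => t) (fun _ => ht0) ζ = t • ζ := fun ζ => by
    ext j; simp
  rw [← lintegral_indicator measurableSet_ball, ← lintegral_indicator measurableSet_ball]
  simp only [hs, ht, one_pow, Finset.prod_const_one, inv_one, ENNReal.ofReal_one, one_mul] at h
  rw [← h]
  refine lintegral_congr fun ζ => ?_
  simp [indicator, norm_smul, ht]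

theorem enorm_le_lintegral_circle {h : ℂ → ℂ} (hc : Continuous h)
    (hd : DifferentiableOn ℂ h (ball 0 1)) :
    ENNReal.ofReal (2 * Real.pi) * ‖h 0‖ₑ
      ≤ ∫⁻ θ in Ioc 0 (2 * Real.pi), ‖h (circleMap 0 1 θ)‖ₑ := by
  have hm : Real.circleAverage h 0 1 = h 0 :=
    DiffContOnCl.circleAverage ⟨by simpa using hd, hc.continuousOn⟩
  have hpi : 0 < 2 * Real.pi := Real.two_pi_pos
  have h2 : (2 * Real.pi) • h 0 = ∫ θ in Ioc 0 (2 * Real.pi), h (circleMap 0 1 θ) := by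
    rw [← hm, Real.circleAverage_def, intervalIntegral.integral_of_le hpi.le, smul_smul,
      mul_inv_cancel₀ hpi.ne', one_smul]
  calc ENNReal.ofReal (2 * Real.pi) * ‖h 0‖ₑ = ‖(2 * Real.pi) • h 0‖ₑ := by
        rw [enorm_smul, Real.enorm_eq_ofReal hpi.le]
    _ ≤ _ := by rw [h2]; exact enorm_integral_le_lintegral_enorm _

/-- Apply the one-variable inequality on each disc `t ↦ t • ζ`, integrate over `ζ`, and swap the
integrals; rotation invariance makes the inner integral independent of `θ`. -/
theorem enorm_mul_volume_ball_le_lintegral {n : ℕ} {G : EuclideanSpace ℂ (Fin n) → ℂ} {r : ℝ}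
    (hc : Continuous G) (hd : DifferentiableOn ℂ G (ball 0 r)) :
    ‖G 0‖ₑ * volume (ball (0 : EuclideanSpace ℂ (Fin n)) r) ≤ ∫⁻ ζ in ball 0 r, ‖G ζ‖ₑ := by
  have hpi : 0 < 2 * Real.pi := Real.two_pi_pos
  have hline : ∀ ζ ∈ ball (0 : EuclideanSpace ℂ (Fin n)) r,
      ENNReal.ofReal (2 * Real.pi) * ‖G 0‖ₑ
        ≤ ∫⁻ θ in Ioc 0 (2 * Real.pi), ‖G (circleMap 0 1 θ • ζ)‖ₑ := by
    intro ζ hζ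
    have := enorm_le_lintegral_circle (h := fun t => G (t • ζ)) (by fun_prop) ?_
    · simpa using this
    · refine hd.comp (by fun_prop) fun t ht => ?_
      simp only [mem_ball_zero_iff, norm_smul] at *
      exact lt_of_le_of_lt (mul_le_of_le_one_left (norm_nonneg _) ht.le) hζ
  have key : ENNReal.ofReal (2 * Real.pi) * (‖G 0‖ₑ * volume (ball (0 : EuclideanSpace ℂ (Fin n)) r))
      ≤ ENNReal.ofReal (2 * Real.pi) * ∫⁻ ζ in ball 0 r, ‖G ζ‖ₑ := by
    calc _ = ∫⁻ _ζ in ball (0 : EuclideanSpace ℂ (Fin n)) r,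
            ENNReal.ofReal (2 * Real.pi) * ‖G 0‖ₑ := by
          rw [setLIntegral_const, mul_assoc]
      _ ≤ ∫⁻ ζ in ball (0 : EuclideanSpace ℂ (Fin n)) r,
            ∫⁻ θ in Ioc 0 (2 * Real.pi), ‖G (circleMap 0 1 θ • ζ)‖ₑ :=
          setLIntegral_mono' measurableSet_ball hline
      _ = ∫⁻ θ in Ioc 0 (2 * Real.pi), ∫⁻ ζ in ball (0 : EuclideanSpace ℂ (Fin n)) r,
            ‖G (circleMap 0 1 θ • ζ)‖ₑ := by
          refine lintegral_lintegral_swap (Continuous.aemeasurable ?_)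
          have : Continuous (circleMap 0 1) := continuous_circleMap 0 1
          unfold Function.uncurry
          fun_prop
      _ = ∫⁻ _θ in Ioc 0 (2 * Real.pi), ∫⁻ ζ in ball (0 : EuclideanSpace ℂ (Fin n)) r,
            ‖G ζ‖ₑ := by
          refine lintegral_congr fun θ => ?_
          exact lintegral_ball_smul r _ (by simp) (fun ζ => ‖G ζ‖ₑ)
      _ = _ := by
          rw [setLIntegral_const, Real.volume_Ioc, sub_zero, mul_comm]
  rwa [ENNReal.mul_le_mul_iff_right (by simpa using hpi) ENNReal.ofReal_ne_top] at key

/-! ### Cauchy–Riemann equations -/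

theorem differentiableAt_of_dbar_eq_zero {n : ℕ} {u : EuclideanSpace ℂ (Fin n) → ℂ}
    {z : EuclideanSpace ℂ (Fin n)} (hu : DifferentiableAt ℝ u z) (h : dbar u z = 0) :
    DifferentiableAt ℂ u z := by
  rw [differentiableAt_iff_restrictScalars ℝ hu]
  set L := fderiv ℝ u z
  have hI : ∀ j, L (EuclideanSpace.single j Complex.I)
      = Complex.I * L (EuclideanSpace.single j 1) := by
    intro j
    have hj : (L (EuclideanSpace.single j 1)
      + Complex.I * L (EuclideanSpace.single j Complex.I)) / 2 = 0 := congrFun h j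
    linear_combination (-2 * Complex.I) * hj + L (EuclideanSpace.single j Complex.I) * Complex.I_sq
  have hsingle : ∀ j (c : ℂ), L (EuclideanSpace.single j c)
      = c * L (EuclideanSpace.single j 1) := by
    intro j c
    have hc : EuclideanSpace.single j c
        = c.re • EuclideanSpace.single j (1 : ℂ) + c.im • EuclideanSpace.single j Complex.I := by
      ext i
      by_cases hij : i = j
      · subst hij; simp [Complex.re_add_im]
      · simp [hij]
    rw [hc, map_add, map_smul, map_smul, hI, Complex.real_smul, Complex.real_smul]
    conv_rhs => rw [← Complex.re_add_im c]
    ring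
  have hsum : ∀ v, L v = ∑ j, v j * L (EuclideanSpace.single j 1) := by
    intro v
    have hv : v = ∑ j, EuclideanSpace.single j (v j) := by
      ext i; simp [Pi.single_apply]
    conv_lhs => rw [hv, map_sum]
    exact Finset.sum_congr rfl fun j _ => hsingle j _
  refine ⟨⟨⟨⟨L, L.map_add⟩, fun c v => ?_⟩, L.continuous⟩, by ext v; rfl⟩
  change L (c • v) = c • L v
  rw [hsum (c • v), hsum v, Finset.smul_sum]
  simp [mul_assoc]

/-! ### Comparison of weights at points with comparable coordinates -/

theorem rpow_le_rpow_abs_mul {x y c : ℝ} (a : ℝ) (hx : 0 < x) (hy : 0 < y) (hc : 0 < c)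
    (hxy : x ≤ c * y) (hyx : y ≤ c * x) : x ^ a ≤ c ^ |a| * y ^ a := by
  rcases le_total 0 a with ha | ha
  · rw [abs_of_nonneg ha, ← Real.mul_rpow hc.le hy.le]
    exact Real.rpow_le_rpow hx.le hxy ha
  · rw [abs_of_nonpos ha]
    have h : (c * x) ^ a ≤ y ^ a := Real.rpow_le_rpow_of_nonpos hy hyx ha
    rw [Real.mul_rpow hc.le hx.le] at h
    calc x ^ a = c ^ (-a) * (c ^ a * x ^ a) := by
          rw [← mul_assoc, ← Real.rpow_add hc, neg_add_cancel, Real.rpow_zero, one_mul]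
      _ ≤ _ := by gcongr

theorem norm_le_mul_norm_of_forall {n : ℕ} {x y : EuclideanSpace ℂ (Fin n)} {c : ℝ} (hc : 0 ≤ c)
    (h : ∀ j, ‖x j‖ ≤ c * ‖y j‖) : ‖x‖ ≤ c * ‖y‖ := by
  rw [EuclideanSpace.norm_eq, EuclideanSpace.norm_eq]
  refine Real.sqrt_le_iff.2 ⟨by positivity, ?_⟩
  rw [mul_pow, Real.sq_sqrt (by positivity), Finset.mul_sum]
  refine Finset.sum_le_sum fun j _ => ?_
  rw [← mul_pow]
  exact pow_le_pow_left₀ (norm_nonneg _) (h j) 2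

theorem inner_Log {n : ℕ} (s : EuclideanSpace ℝ (Fin n)) (z : EuclideanSpace ℂ (Fin n)) :
    inner ℝ s (Log z) = ∑ j, s j * Real.log ‖z j‖ := by
  simp [PiLp.inner_apply, Log, mul_comm]

theorem nu_eq_sum {n : ℕ} (z : EuclideanSpace ℂ (Fin n)) : nu z = ∑ j, Real.log ‖z j‖ := by
  simp [nu, inner_Log]

theorem prod_norm_sq_eq_exp_nu {n : ℕ} {z : EuclideanSpace ℂ (Fin n)} (hz : z ∈ cstar n) :
    ∏ j, ‖z j‖ ^ 2 = Real.exp (2 * nu z) := by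
  rw [nu_eq_sum, Finset.mul_sum, Real.exp_sum]
  refine Finset.prod_congr rfl fun j _ => ?_
  rw [two_mul, Real.exp_add, Real.exp_log (norm_pos_iff.2 (hz j)), sq]

theorem bddAbove_inner_image {n : ℕ} {S : Set (EuclideanSpace ℝ (Fin n))} {M : ℝ}
    (hM : ∀ s ∈ S, ‖s‖ ≤ M) (ξ : EuclideanSpace ℝ (Fin n)) :
    BddAbove ((fun s => inner ℝ s ξ) '' S) := by
  refine ⟨M * ‖ξ‖, ?_⟩
  rintro _ ⟨s, hs, rfl⟩
  exact (real_inner_le_norm s ξ).trans (by gcongr; exact hM s hs)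

theorem suppFun_nonneg {n : ℕ} {S : Set (EuclideanSpace ℝ (Fin n))} {M : ℝ}
    (hM : ∀ s ∈ S, ‖s‖ ≤ M) (h0 : (0 : EuclideanSpace ℝ (Fin n)) ∈ S)
    (ξ : EuclideanSpace ℝ (Fin n)) : 0 ≤ suppFun S ξ :=
  le_csSup (bddAbove_inner_image hM ξ) ⟨0, h0, by simp⟩

theorem log_norm_le_add_log_two {x y : ℂ} (hx : x ≠ 0) (hy : y ≠ 0) (h : ‖x‖ ≤ 2 * ‖y‖) :
    Real.log ‖x‖ ≤ Real.log ‖y‖ + Real.log 2 := by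
  rw [← Real.log_mul (norm_ne_zero_iff.2 hy) two_ne_zero, mul_comm]
  exact Real.log_le_log (norm_pos_iff.2 hx) h

theorem nu_le_nu_add {n : ℕ} {z w : EuclideanSpace ℂ (Fin n)} (hz : z ∈ cstar n)
    (hw : w ∈ cstar n) (h : ∀ j, ‖w j‖ ≤ 2 * ‖z j‖) : nu w ≤ nu z + n * Real.log 2 := by
  have := Finset.sum_le_sum fun j (_ : j ∈ Finset.univ) =>
    log_norm_le_add_log_two (hw j) (hz j) (h j)
  simpa [nu_eq_sum, Finset.sum_add_distrib] using this

/-- Since `0 ≤ s j ≤ M`, raising each `log ‖z j‖` by at most `log 2` raises each term of the pairing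
by at most `M * log 2`. -/
theorem suppFun_Log_le_add {n : ℕ} {S : Set (EuclideanSpace ℝ (Fin n))} {M : ℝ}
    (hM : ∀ s ∈ S, ‖s‖ ≤ M) (hS : ∀ s ∈ S, ∀ j, 0 ≤ s j) (hne : S.Nonempty)
    {z w : EuclideanSpace ℂ (Fin n)} (hz : z ∈ cstar n) (hw : w ∈ cstar n)
    (h : ∀ j, ‖w j‖ ≤ 2 * ‖z j‖) :
    suppFun S (Log w) ≤ suppFun S (Log z) + n * (M * Real.log 2) := by
  refine csSup_le (hne.image _) ?_
  rintro _ ⟨s, hs, rfl⟩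
  have h1 : inner ℝ s (Log z) ≤ suppFun S (Log z) :=
    le_csSup (bddAbove_inner_image hM _) ⟨s, hs, rfl⟩
  refine le_trans ?_ (add_le_add_left h1 _)
  simp only [inner_Log]
  have h2 : ∀ j ∈ Finset.univ, s j * Real.log ‖w j‖
      ≤ s j * Real.log ‖z j‖ + M * Real.log 2 := by
    intro j _
    have h3 : s j ≤ M := (le_abs_self _).trans ((PiLp.norm_apply_le s j).trans (hM s hs))
    have h4 := mul_le_mul_of_nonneg_left (log_norm_le_add_log_two (hw j) (hz j) (h j)) (hS s hs j)
    have h5 := mul_le_mul_of_nonneg_right h3 (Real.log_nonneg one_le_two)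
    linarith
  simpa [Finset.sum_add_distrib] using Finset.sum_le_sum h2

theorem suppFun_Log_le_log_norm {n : ℕ} {S : Set (EuclideanSpace ℝ (Fin n))} {M : ℝ}
    (hM : ∀ s ∈ S, ‖s‖ ≤ M) (hS : ∀ s ∈ S, ∀ j, 0 ≤ s j) (hne : S.Nonempty)
    {w : EuclideanSpace ℂ (Fin n)} (hw : w ∈ cstar n) :
    suppFun S (Log w) ≤ n * (M * Real.log (1 + ‖w‖)) := by
  refine csSup_le (hne.image _) ?_
  rintro _ ⟨s, hs, rfl⟩
  simp only [inner_Log]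
  have h2 : ∀ j ∈ Finset.univ, s j * Real.log ‖w j‖ ≤ M * Real.log (1 + ‖w‖) := by
    intro j _
    have h3 : s j ≤ M := (le_abs_self _).trans ((PiLp.norm_apply_le s j).trans (hM s hs))
    have h4 : Real.log ‖w j‖ ≤ Real.log (1 + ‖w‖) :=
      Real.log_le_log (norm_pos_iff.2 (hw j)) (by linarith [PiLp.norm_apply_le w j])
    have h5 : 0 ≤ Real.log (1 + ‖w‖) := Real.log_nonneg (by linarith [norm_nonneg w])
    exact (mul_le_mul_of_nonneg_left h4 (hS s hs j)).trans (mul_le_mul_of_nonneg_right h3 h5)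
  simpa using Finset.sum_le_sum h2

/-! ### Extension across the coordinate hyperplanes -/

theorem dense_cstar (n : ℕ) : Dense (cstar n) := by
  intro z
  have h1 : Filter.Tendsto (fun t : ℂ => z + t • (WithLp.toLp 2 fun _ => (1 : ℂ)))
      (𝓝[≠] 0) (𝓝 z) := by
    have : Continuous fun t : ℂ =>
        z + t • (WithLp.toLp 2 fun _ => (1 : ℂ) : EuclideanSpace ℂ (Fin n)) := by fun_prop
    simpa using (this.tendsto 0).mono_left nhdsWithin_le_nhds
  refine mem_closure_of_tendsto h1 ?_
  have h2 : ∀ j, ∀ᶠ t : ℂ in 𝓝[≠] 0, z j + t ≠ 0 := by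
    intro j
    by_cases hj : z j = 0
    · filter_upwards [self_mem_nhdsWithin] with t ht
      simpa [hj] using ht
    · exact ((continuous_const.add continuous_id).continuousAt.eventually_ne
        (by simpa using hj)).filter_mono nhdsWithin_le_nhds
  filter_upwards [Filter.eventually_all.2 h2] with t ht
  intro j
  simpa using ht j

theorem logSuppFun_of_mem {n : ℕ} {S : Set (EuclideanSpace ℝ (Fin n))}
    {z : EuclideanSpace ℂ (Fin n)} (hz : z ∈ cstar n) : logSuppFun S z = suppFun S (Log z) := by
  simp [logSuppFun, hz]

/-- A bound by `e^{m H_S}` on `ℂ*ⁿ` extends to `ℂⁿ`, by continuity and the definition of `H_S`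
on the coordinate hyperplanes. -/
theorem norm_le_of_forall_mem_cstar {n m : ℕ} {S : Set (EuclideanSpace ℝ (Fin n))} {M : ℝ}
    (hM : ∀ s ∈ S, ‖s‖ ≤ M) (hS : ∀ s ∈ S, ∀ j, 0 ≤ s j)
    (h0 : (0 : EuclideanSpace ℝ (Fin n)) ∈ S)
    {u : EuclideanSpace ℂ (Fin n) → ℂ} (hu : Continuous u)
    {p : EuclideanSpace ℂ (Fin n) → ℝ} (hp : Continuous p) (hp0 : ∀ z, 0 ≤ p z)
    (h : ∀ z ∈ cstar n, ‖u z‖ ≤ p z * Real.exp (m * suppFun S (Log z)))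
    (z : EuclideanSpace ℂ (Fin n)) : ‖u z‖ ≤ p z * Real.exp (m * logSuppFun S z) := by
  by_cases hz : z ∈ cstar n
  · rw [logSuppFun_of_mem hz]; exact h z hz
  have hM0 : 0 ≤ M := (norm_nonneg _).trans (hM 0 h0)
  have : (𝓝[cstar n] z).NeBot := mem_closure_iff_nhdsWithin_neBot.1 (dense_cstar n z)
  have hbdd : Filter.IsBoundedUnder (· ≤ ·) (𝓝[cstar n] z) fun w => suppFun S (Log w) := by
    refine ⟨n * (M * Real.log (1 + (‖z‖ + 1))), Filter.eventually_map.2 ?_⟩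
    have h1 : ∀ᶠ w in 𝓝[cstar n] z, ‖w‖ < ‖z‖ + 1 :=
      (continuous_norm.continuousAt.eventually_lt continuousAt_const (by simp)).filter_mono
        nhdsWithin_le_nhds
    filter_upwards [h1, self_mem_nhdsWithin] with w hw hwc
    refine (suppFun_Log_le_log_norm hM hS ⟨0, h0⟩ hwc).trans ?_
    have : 0 < 1 + ‖w‖ := by positivity
    gcongr
  -- Near `z`, `φ_S ∘ Log` is eventually below its upper limit plus `ε`; the bound passes to `z` by
  -- continuity, and then `ε → 0`.
  have hε : ∀ ε > 0, ‖u z‖ ≤ p z * Real.exp (m * (logSuppFun S z + ε)) := by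
    intro ε hε
    have hlt : Filter.limsup (fun w => suppFun S (Log w)) (𝓝[cstar n] z)
        < logSuppFun S z + ε := by
      simp [logSuppFun, hz, hε]
    have hev := Filter.eventually_lt_of_limsup_lt hlt hbdd
    refine le_of_tendsto_of_tendsto (b := 𝓝[cstar n] z) ((hu.norm.tendsto z).mono_left nhdsWithin_le_nhds)
      (((hp.mul continuous_const).tendsto z).mono_left nhdsWithin_le_nhds) ?_
    filter_upwards [hev, self_mem_nhdsWithin] with w hw hwc
    refine (h w hwc).trans ?_
    exact mul_le_mul_of_nonneg_left (Real.exp_le_exp.2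
      (mul_le_mul_of_nonneg_left hw.le (Nat.cast_nonneg m))) (hp0 w)
  have hcont : Continuous fun ε : ℝ => p z * Real.exp (m * (logSuppFun S z + ε)) := by fun_prop
  have hlim : Filter.Tendsto (fun ε : ℝ => p z * Real.exp (m * (logSuppFun S z + ε)))
      (𝓝[>] 0) (𝓝 (p z * Real.exp (m * logSuppFun S z))) := by
    simpa using (hcont.tendsto 0).mono_left nhdsWithin_le_nhds
  exact ge_of_tendsto hlim (by filter_upwards [self_mem_nhdsWithin] with ε h using hε ε h)

/-! ### Pointwise bound from the weighted integral -/

/-- The weighted density `|u|² (1 + |z|²)^{-a} e^{-2mH_S - 2ν}`. -/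
noncomputable def weightedDensity {n : ℕ} (m : ℕ) (a : ℝ) (S : Set (EuclideanSpace ℝ (Fin n)))
    (u : EuclideanSpace ℂ (Fin n) → ℂ) (z : EuclideanSpace ℂ (Fin n)) : ℝ :=
  ‖u z‖ ^ 2 * (1 + ‖z‖ ^ 2) ^ (-a) * Real.exp (-2 * m * logSuppFun S z - 2 * nu z)

theorem norm_sq_le_weightedDensity {n m : ℕ} (a : ℝ) {S : Set (EuclideanSpace ℝ (Fin n))} {M : ℝ}
    (hM : ∀ s ∈ S, ‖s‖ ≤ M) (hS : ∀ s ∈ S, ∀ j, 0 ≤ s j) (hne : S.Nonempty)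
    (u : EuclideanSpace ℂ (Fin n) → ℂ) {z w : EuclideanSpace ℂ (Fin n)}
    (hz : z ∈ cstar n) (hw : w ∈ cstar n)
    (hwz : ∀ j, ‖w j‖ ≤ 2 * ‖z j‖) (hzw : ∀ j, ‖z j‖ ≤ 2 * ‖w j‖) :
    ‖u w‖ ^ 2 ≤ ((4 ^ |a| * Real.exp (2 * m * (n * (M * Real.log 2)) + 2 * (n * Real.log 2)))
      * ((1 + ‖z‖ ^ 2) ^ a * Real.exp (2 * m * suppFun S (Log z))) * Real.exp (2 * nu z))
        * weightedDensity m a S u w := by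
  have h1 := norm_le_mul_norm_of_forall zero_le_two hwz
  have h2 := norm_le_mul_norm_of_forall zero_le_two hzw
  -- The 4 is the square of the factor 2 between the norms.
  have hpow : (1 + ‖w‖ ^ 2) ^ a ≤ 4 ^ |a| * (1 + ‖z‖ ^ 2) ^ a :=
    rpow_le_rpow_abs_mul a (by positivity) (by positivity) (by norm_num)
      (by nlinarith [norm_nonneg w]) (by nlinarith [norm_nonneg z])
  have hH := suppFun_Log_le_add hM hS hne hz hw hwz
  have hν := nu_le_nu_add hz hw hwz
  have hexp : Real.exp (2 * m * suppFun S (Log w) + 2 * nu w)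
      ≤ Real.exp (2 * m * (suppFun S (Log z) + n * (M * Real.log 2))
        + 2 * (nu z + n * Real.log 2)) := by gcongr
  have hd : 0 ≤ weightedDensity m a S u w := by unfold weightedDensity; positivity
  calc ‖u w‖ ^ 2 = ((1 + ‖w‖ ^ 2) ^ a * Real.exp (2 * m * suppFun S (Log w) + 2 * nu w))
        * weightedDensity m a S u w := by
        have hpos : 0 < 1 + ‖w‖ ^ 2 := by positivity
        have e1 : (1 + ‖w‖ ^ 2) ^ a * (1 + ‖w‖ ^ 2) ^ (-a) = 1 := by
          rw [← Real.rpow_add hpos, add_neg_cancel, Real.rpow_zero]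
        have e2 : Real.exp (2 * m * suppFun S (Log w) + 2 * nu w)
            * Real.exp (-2 * m * suppFun S (Log w) - 2 * nu w) = 1 := by
          rw [← Real.exp_add, Real.exp_eq_one_iff]; ring
        rw [weightedDensity, logSuppFun_of_mem hw]
        calc ‖u w‖ ^ 2 = ‖u w‖ ^ 2 * 1 * 1 := by ring
          _ = ‖u w‖ ^ 2 * ((1 + ‖w‖ ^ 2) ^ a * (1 + ‖w‖ ^ 2) ^ (-a))
              * (Real.exp (2 * m * suppFun S (Log w) + 2 * nu w)
                * Real.exp (-2 * m * suppFun S (Log w) - 2 * nu w)) := by rw [e1, e2]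
          _ = _ := by ring
    _ ≤ ((4 ^ |a| * (1 + ‖z‖ ^ 2) ^ a)
          * Real.exp (2 * m * (suppFun S (Log z) + n * (M * Real.log 2))
            + 2 * (nu z + n * Real.log 2))) * weightedDensity m a S u w := by gcongr
    _ = _ := by
        have : 2 * m * (suppFun S (Log z) + n * (M * Real.log 2)) + 2 * (nu z + n * Real.log 2)
          = (2 * m * (n * (M * Real.log 2)) + 2 * (n * Real.log 2))
            + 2 * m * suppFun S (Log z) + 2 * nu z := by ring
        rw [this, Real.exp_add, Real.exp_add]
        ring

theorem norm_sq_mul_volume_le {n m : ℕ} (a : ℝ) {S : Set (EuclideanSpace ℝ (Fin n))} {M : ℝ}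
    (hM : ∀ s ∈ S, ‖s‖ ≤ M) (hS : ∀ s ∈ S, ∀ j, 0 ≤ s j) (hne : S.Nonempty)
    {u : EuclideanSpace ℂ (Fin n) → ℂ} (hu : Continuous u) {R : ℝ}
    (hd : ∀ z, R < ‖z‖ → DifferentiableAt ℂ u z)
    {z : EuclideanSpace ℂ (Fin n)} (hz : z ∈ cstar n) (hzR : 2 * R < ‖z‖) :
    ENNReal.ofReal (‖u z‖ ^ 2) * volume (ball (0 : EuclideanSpace ℂ (Fin n)) (1 / 2))
      ≤ ENNReal.ofReal
        ((4 ^ |a| * Real.exp (2 * m * (n * (M * Real.log 2)) + 2 * (n * Real.log 2)))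
          * ((1 + ‖z‖ ^ 2) ^ a * Real.exp (2 * m * suppFun S (Log z))))
        * ∫⁻ w, ENNReal.ofReal (weightedDensity m a S u w) := by
  let D := diagEquiv (fun j => z j) hz
  have hDc : Continuous D := (D.restrictScalars ℝ).toContinuousLinearEquiv.continuous
  have hDd : Differentiable ℂ D := D.toContinuousLinearEquiv.differentiable
  have hcoord : ∀ ζ j, (z + D ζ) j = z j * (1 + ζ j) := fun ζ j => by
    rw [PiLp.add_apply, show D ζ j = z j * ζ j from rfl, mul_add, mul_one]
  have hζ : ∀ ζ ∈ ball (0 : EuclideanSpace ℂ (Fin n)) (1 / 2), z + D ζ ∈ cstar n ∧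
      (∀ j, ‖(z + D ζ) j‖ ≤ 2 * ‖z j‖) ∧ ∀ j, ‖z j‖ ≤ 2 * ‖(z + D ζ) j‖ := by
    intro ζ hζ
    have hj : ∀ j, ‖ζ j‖ < 1 / 2 := fun j =>
      (PiLp.norm_apply_le ζ j).trans_lt (by simpa using hζ)
    have hup : ∀ j, ‖1 + ζ j‖ ≤ 2 := fun j => by
      have := norm_add_le (1 : ℂ) (ζ j)
      rw [norm_one] at this
      linarith [hj j]
    have hlow : ∀ j, 1 / 2 ≤ ‖1 + ζ j‖ := fun j => by
      have := norm_sub_le (1 + ζ j) (ζ j)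
      rw [add_sub_cancel_right, norm_one] at this
      linarith [hj j]
    refine ⟨fun j => ?_, fun j => ?_, fun j => ?_⟩
    · rw [hcoord]
      exact mul_ne_zero (hz j) (norm_pos_iff.1 (by linarith [hlow j]))
    · rw [hcoord, norm_mul]
      nlinarith [norm_nonneg (z j), hup j]
    · rw [hcoord, norm_mul]
      nlinarith [norm_nonneg (z j), hlow j]
  have hG : DifferentiableOn ℂ (fun ζ => u (z + D ζ) ^ 2) (ball 0 (1 / 2)) := by
    intro ζ hmem
    -- `2R < ‖z‖ ≤ 2‖z + D ζ‖` keeps the point where `u` is holomorphic.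
    have h2 := norm_le_mul_norm_of_forall zero_le_two (hζ ζ hmem).2.2
    have h3 : DifferentiableAt ℂ (fun ζ => u (z + D ζ)) ζ :=
      (hd (z + D ζ) (by linarith)).comp ζ ((hDd ζ).const_add z)
    exact (h3.pow 2).differentiableWithinAt
  have hmean := enorm_mul_volume_ball_le_lintegral (G := fun ζ => u (z + D ζ) ^ 2)
    (by fun_prop) hG
  have henorm : ∀ x : ℂ, ‖x ^ 2‖ₑ = ENNReal.ofReal (‖x‖ ^ 2) := fun x => by
    rw [← ofReal_norm, norm_pow]
  simp only [henorm, map_zero, add_zero] at hmean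
  refine hmean.trans ?_
  set K := (4 ^ |a| * Real.exp (2 * m * (n * (M * Real.log 2)) + 2 * (n * Real.log 2)))
          * ((1 + ‖z‖ ^ 2) ^ a * Real.exp (2 * m * suppFun S (Log z)))
  have hK : 0 ≤ K := by positivity
  calc ∫⁻ ζ in ball 0 (1 / 2), ENNReal.ofReal (‖u (z + D ζ)‖ ^ 2)
      ≤ ∫⁻ ζ in ball 0 (1 / 2), ENNReal.ofReal (K * Real.exp (2 * nu z))
          * ENNReal.ofReal (weightedDensity m a S u (z + D ζ)) := by
        refine setLIntegral_mono' measurableSet_ball fun ζ hmem => ?_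
        obtain ⟨h1, h2, h3⟩ := hζ ζ hmem
        rw [← ENNReal.ofReal_mul (by positivity)]
        exact ENNReal.ofReal_le_ofReal (norm_sq_le_weightedDensity a hM hS hne u hz h1 h2 h3)
    _ ≤ ∫⁻ ζ, ENNReal.ofReal (K * Real.exp (2 * nu z))
          * ENNReal.ofReal (weightedDensity m a S u (z + D ζ)) := setLIntegral_le_lintegral _ _
    _ = ENNReal.ofReal (K * Real.exp (2 * nu z)) * (ENNReal.ofReal (Real.exp (2 * nu z))⁻¹
          * ∫⁻ w, ENNReal.ofReal (weightedDensity m a S u w)) := by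
        rw [lintegral_const_mul' _ _ ENNReal.ofReal_ne_top,
          lintegral_comp_diagEquiv (fun j => z j) hz
            (fun x => ENNReal.ofReal (weightedDensity m a S u (z + x))),
          prod_norm_sq_eq_exp_nu hz,
          lintegral_add_left_eq_self (fun x => ENNReal.ofReal (weightedDensity m a S u x)) z]
    _ = _ := by
        -- The inverse Jacobian cancels the factor `e^{2ν(z)}` coming from the weight.
        rw [← mul_assoc, ← ENNReal.ofReal_mul (by positivity), mul_assoc,
          mul_inv_cancel₀ (Real.exp_pos _).ne', mul_one]

end LogSupport

/-! ### Near and far regions combined -/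

open LogSupport in
theorem proposition5p2 (n m : ℕ) (a : ℝ)
    (S : Set (EuclideanSpace ℝ (Fin n)))
    (hS_compact : IsCompact S) (hS_convex : Convex ℝ S)
    (hS_nonneg : ∀ s ∈ S, ∀ j, 0 ≤ s j) (hS_zero : (0 : EuclideanSpace ℝ (Fin n)) ∈ S)
    (u : EuclideanSpace ℂ (Fin n) → ℂ) (hu : ContDiff ℝ 1 u)
    (hdbar : HasCompactSupport (LogSupport.dbar u))
    (hint : ∫⁻ z : EuclideanSpace ℂ (Fin n),
        ENNReal.ofReal (‖u z‖ ^ 2 * (1 + ‖z‖ ^ 2) ^ (-a)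
          * Real.exp (-2 * m * LogSupport.logSuppFun S z - 2 * LogSupport.nu z)) < ⊤) :
    ∃ C : ℝ, 0 < C ∧ ∀ z : EuclideanSpace ℂ (Fin n),
      ‖u z‖ ≤ C * (1 + ‖z‖) ^ a * Real.exp (m * LogSupport.logSuppFun S z) := by
  have hucont := hu.continuous
  replace hint : ∫⁻ z, ENNReal.ofReal (weightedDensity m a S u z) < ⊤ := hint
  obtain ⟨M, hM⟩ := hS_compact.isBounded.exists_norm_le
  obtain ⟨R, hR⟩ := hdbar.isCompact.isBounded.exists_norm_le
  have hhol : ∀ z, R < ‖z‖ → DifferentiableAt ℂ u z := fun z hz =>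
    differentiableAt_of_dbar_eq_zero (hu.differentiable one_ne_zero z)
      (image_eq_zero_of_notMem_tsupport fun h => hz.not_ge (hR z h))
  have hpc : Continuous fun z : EuclideanSpace ℂ (Fin n) => (1 + ‖z‖) ^ a :=
    (continuous_const.add continuous_norm).rpow_const fun z =>
      Or.inl (by positivity : (0 : ℝ) < 1 + ‖z‖).ne'
  have hppos : ∀ z : EuclideanSpace ℂ (Fin n), 0 < (1 + ‖z‖) ^ a := fun z => by positivity
  obtain ⟨C₁, hC₁⟩ := (isCompact_closedBall (0 : EuclideanSpace ℂ (Fin n)) (2 * R)).exists_bound_of_continuousOn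
    (f := fun z => ‖u z‖ / (1 + ‖z‖) ^ a)
    (hucont.norm.div hpc fun z => (hppos z).ne').continuousOn
  set V := (MeasureTheory.volume (Metric.ball (0 : EuclideanSpace ℂ (Fin n)) (1 / 2))).toReal
  have hVtop : MeasureTheory.volume (Metric.ball (0 : EuclideanSpace ℂ (Fin n)) (1 / 2)) ≠ ⊤ :=
    MeasureTheory.measure_ball_lt_top.ne
  have hV : 0 < V := ENNReal.toReal_pos (Metric.measure_ball_pos _ _ (by norm_num)).ne' hVtop
  set I := (∫⁻ w, ENNReal.ofReal (weightedDensity m a S u w)).toReal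
  have hI : 0 ≤ I := ENNReal.toReal_nonneg
  set K := 4 ^ |a| * Real.exp (2 * m * (n * (M * Real.log 2)) + 2 * (n * Real.log 2))
  have hK : 0 < K := by positivity
  set C₂ := Real.sqrt (K * 2 ^ |a| * I / V)
  have hfar : ∀ z ∈ cstar n, 2 * R < ‖z‖ →
      ‖u z‖ ≤ C₂ * (1 + ‖z‖) ^ a * Real.exp (m * suppFun S (Log z)) := by
    intro z hz hzR
    have h := norm_sq_mul_volume_le (m := m) a hM hS_nonneg ⟨0, hS_zero⟩ hucont hhol hz hzR
    have h' := ENNReal.toReal_mono (ENNReal.mul_ne_top ENNReal.ofReal_ne_top hint.ne) h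
    rw [ENNReal.toReal_mul, ENNReal.toReal_mul, ENNReal.toReal_ofReal (by positivity),
      ENNReal.toReal_ofReal (by positivity)] at h'
    have hpow : (1 + ‖z‖ ^ 2) ^ a ≤ 2 ^ |a| * ((1 + ‖z‖) ^ a) ^ 2 := by
      rw [Real.rpow_pow_comm (by positivity)]
      exact rpow_le_rpow_abs_mul a (by positivity) (by positivity) two_pos
        (by nlinarith [norm_nonneg z]) (by nlinarith [sq_nonneg (1 - ‖z‖)])
    refine le_of_sq_le_sq ?_ (by positivity)
    have hexp : Real.exp (2 * m * suppFun S (Log z)) = Real.exp (m * suppFun S (Log z)) ^ 2 := by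
      rw [← Real.exp_nat_mul]; congr 1; push_cast; ring
    rw [mul_pow, mul_pow, Real.sq_sqrt (by positivity), div_mul_eq_mul_div, div_mul_eq_mul_div,
      le_div_iff₀ hV, ← hexp]
    refine h'.trans ?_
    calc _ ≤ K * ((2 ^ |a| * ((1 + ‖z‖) ^ a) ^ 2) * Real.exp (2 * m * suppFun S (Log z))) * I := by
          gcongr
      _ = _ := by ring
  -- The `+ 1` gives strict positivity, as `C₂` may vanish.
  set C := max C₁ C₂ + 1
  have hC : 0 < C := by
    have : 0 ≤ C₂ := Real.sqrt_nonneg _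
    have := le_max_right C₁ C₂
    linarith
  refine ⟨C, hC, norm_le_of_forall_mem_cstar (p := fun z => C * (1 + ‖z‖) ^ a)
    hM hS_nonneg hS_zero hucont (continuous_const.mul hpc)
    (fun z => (mul_pos hC (hppos z)).le) fun z hz => ?_⟩
  rcases le_or_gt ‖z‖ (2 * R) with hzR | hzR
  · have h1 := hC₁ z (by simpa using hzR)
    rw [norm_div, norm_norm, Real.norm_of_nonneg (hppos z).le, div_le_iff₀ (hppos z)] at h1
    have h2 : C₁ ≤ C := (le_max_left C₁ C₂).trans (by simp [C])
    have h3 : 1 ≤ Real.exp (m * suppFun S (Log z)) :=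
      Real.one_le_exp (mul_nonneg (Nat.cast_nonneg m) (suppFun_nonneg hM hS_zero _))
    calc ‖u z‖ ≤ C * (1 + ‖z‖) ^ a := h1.trans (by gcongr)
      _ ≤ _ := le_mul_of_one_le_right (mul_pos hC (hppos z)).le h3
  · refine (hfar z hz hzR).trans ?_
    have h2 : C₂ ≤ C := (le_max_right C₁ C₂).trans (by simp [C])
    gcongr
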